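/- **Setting.** Let $g,\Delta x,\Delta y>0$. States are $U=(h,hv_1,hv_2,\mathcal E_{11},\mathcal E_{12},\mathcal E_{22})\in\mathbb R^6$ with $\mathcal E=\frac h2(v\otimes v+\mathcal P)$; the admissible set $\Omega$ consists of those with $h>0$ and $\mathcal P$ symmetric positive definite. The shear shallow water system without source terms is $\partial_tU+\partial_xF^x(U)+\partial_yF^y(U)+B^x(U)\partial_xh+B^y(U)\partial_yh=0$ with $$F^x=\begin{pmatrix}hv_1\\h(v_1^2+\mathcal P_{11})\\h(v_1v_2+\mathcal P_{12})\\\frac12hv_1(v_1^2+3\mathcal P_{11})\\\frac12h(v_1^2v_2+2v_1\mathcal P_{12}+v_2\mathcal P_{11})\\\frac12h(v_1v_2^2+2v_2\mathcal P_{12}+v_1\mathcal P_{22})\end{pmatrix},\quad F^y=\begin{pmatrix}hv_2\\h(v_1v_2+\mathcal P_{12})\\h(v_2^2+\mathcal P_{22})\\\frac12h(v_1^2v_2+2v_1\mathcal P_{12}+v_2\mathcal P_{11})\\\frac12h(v_1v_2^2+2v_2\mathcal P_{12}+v_1\mathcal P_{22})\\\frac12h(v_2^3+3v_2\mathcal P_{22})\end{pmatrix},$$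 $B^x=(0,gh,0,ghv_1,\frac12ghv_2,0)^\top$, $B^y=(0,0,gh,0,\frac12ghv_1,ghv_2)^\top$. Put $D=\det\mathcal P$, $s=\log(D/h^2)$, $\eta=-hs$, $q^x=-hv_1s$, $q^y=-hv_2s$, $V=\partial\eta/\partial U$, $\psi^d=V^\top F^d-q^d$ for $d\in\{x,y\}$. **Entropy conservative fluxes.** For two states write $\bar a$ for the arithmetic mean, $[\![a]\!]$ for the jump, and $a^{\ln}=[\![a]\!]/[\![\ln a]\!]$ ($=a$ for equal arguments). With $\beta_{kl}=\mathcal P_{kl}/D$, $D_\beta=\beta_{11}\beta_{22}-\beta_{12}^2$, $\pi=\bar h/(\bar\beta_{11}\bar\beta_{22}-\bar\beta_{12}^2)$, the two-point flux $\tilde F^d=(f_1,\dots,f_6)$ is: $f_1=h^{\ln}\bar v_1$ for $d=x$ and $h^{\ln}\bar v_2$ for $d=y$; $(f_2,f_3)=(\bar v_1f_1+\bar\beta_{11}\pi,\ \bar v_2f_1+\bar\beta_{12}\pi)$ for $d=x$ and $(\bar v_1f_1+\bar\beta_{12}\pi,\ \bar v_2f_1+\bar\beta_{22}\pi)$ for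 $d=y$; and $$f_4=\tfrac12\Big(\tfrac{\bar\beta_{11}}{D_\beta^{\ln}}-\overline{v_1^2}\Big)f_1+\bar v_1f_2,\quad f_5=\tfrac12\Big(\Big(\tfrac{\bar\beta_{12}}{D_\beta^{\ln}}-\overline{v_1v_2}\Big)f_1+\bar v_1f_3+\bar v_2f_2\Big),\quad f_6=\tfrac12\Big(\tfrac{\bar\beta_{22}}{D_\beta^{\ln}}-\overline{v_2^2}\Big)f_1+\bar v_2f_3 .$$ Put $\tilde q^d=\bar V^\top\tilde F^d-\bar\psi^d$. On a grid line $(U_m)_{m\in\mathbb Z}$ in direction $d$, the second order flux is $\tilde F^{d,2}_{m+1/2}=\tilde F^d(U_m,U_{m+1})$ and the fourth order flux is $\tilde F^{d,4}_{m+1/2}=\frac43\tilde F^d(U_m,U_{m+1})-\frac16\big(\tilde F^d(U_{m-1},U_{m+1})+\tilde F^d(U_m,U_{m+2})\big)$; $\tilde q^{d,2}$, $\tilde q^{d,4}$ are formed from $\tilde q^d$ in the same way. **Dissipation.** With primitive variables $W=(h,v_1,v_2,\mathcal P_{11},\mathcal P_{12},\mathcal P_{22})$ let $\tilde R^d=\frac{\partial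 U}{\partial W}R^d_WT^d$, where $$R_W^x=\begin{pmatrix}h\mathcal P_{11}&0&-h&0&0&h\mathcal P_{11}\\-A\mathcal P_{11}&0&0&0&0&A\mathcal P_{11}\\-A\mathcal P_{12}&-C&0&0&C&A\mathcal P_{12}\\2\mathcal P_{11}^2&0&\mathcal P_{11}&0&0&2\mathcal P_{11}^2\\2\mathcal P_{11}\mathcal P_{12}&\mathcal P_{11}&\mathcal P_{12}&0&\mathcal P_{11}&2\mathcal P_{11}\mathcal P_{12}\\2\mathcal P_{12}^2&2\mathcal P_{12}&0&1&2\mathcal P_{12}&2\mathcal P_{12}^2\end{pmatrix},\quad A=\sqrt{3\mathcal P_{11}},\ C=\sqrt{\mathcal P_{11}},$$ $R_W^y$ is obtained by replacing $\mathcal P_{11}$ by $\mathcal P_{22}$ throughout and exchanging rows 2 with 3 and 4 with 6, and, with $P=\mathcal P_{11}$ for $d=x$ and $P=\mathcal P_{22}$ for $d=y$, $r=\frac{D}{\sqrt3hP}$, $\alpha=\sqrt{\frac{(\sqrt3D+P)^2+\mathcal P_{12}^4}{3hP^2}}$, the matrix $T^d$ is symmetric, with $T_{11}=T_{66}=\frac1{\sqrt{12hP^2}}$,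 $T_{22}=T_{55}=\sqrt{\frac{D}{4hP^2}}$, $T_{33}=\frac{\frac1{3h}+r}{\alpha}$, $T_{34}=T_{43}=\frac{\mathcal P_{12}^2}{3hP\alpha}$, $T_{44}=\frac{\sqrt3D(\sqrt3D+P)+\mathcal P_{12}^4}{3hP^2\alpha}$ and all other entries zero. (The columns of $\tilde R^d$ are right eigenvectors of $\partial F^d/\partial U$, scaled so that $\tilde R^d\tilde R^{d\top}=\partial U/\partial V$.) Let $\Lambda^d=(\max_k|\lambda^d_k|)I$, where $\lambda_k^d$ are the eigenvalues $v_d,v_d,v_d\pm\sqrt{P},v_d\pm\sqrt{3P}$ of $\partial F^d/\partial U$ (here $v_x=v_1$, $v_y=v_2$). At an interface, $\tilde R^d$ and $\Lambda^d$ are evaluated at interface states that are arbitrary $\Omega$-valued functions of the direction and the two adjacent cell values (possibly different functions for $\tilde R^d$ and for $\Lambda^d$). Put $\mathbf D^d_{m+1/2}=\tilde R^d_{m+1/2}\Lambda^d_{m+1/2}\tilde R^{d\top}_{m+1/2}$. **Reconstruction.** At the interface $m+\frac12$ let $\mathcal V_l$ ($l\in\mathbb Z$) be the scaled entropy variables.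 They are given either by $\mathcal V_l=\tilde R_{m+1/2}^{d\top}V_l$ for all $l$, or by $\mathcal V_m=\tilde R_{m+1/2}^{d\top}V_m$ and $\mathcal V_{l+1}-\mathcal V_l=\tilde R_{l+1/2}^{d\top}(V_{l+1}-V_l)$ for all $l$. Let $\tilde{\mathcal V}^{+}_m$, $\tilde{\mathcal V}^-_{m+1}$ be the values at $m+\frac12$ of the reconstructions of $(\mathcal V_l)$, component by component, in the cells $m$ and $m+1$. For O2_ES the reconstruction is piecewise linear with slope $\mathrm{minmod}(\mathcal V_i-\mathcal V_{i-1},\mathcal V_{i+1}-\mathcal V_i)$ in cell $i$; for O3_ES and O4_ES it is the ENO procedure of order 3 and 4. In the latter the stencil of cell $i$ starts as $\{i\}$ and grows by one cell at a time to the side with the smaller absolute undivided difference (to the right in case of a tie), and the polynomial is determined on that stencil either from the $\mathcal V_l$ as cell averages or from the $\mathcal V_l$ as point values. Put $[\![\tilde V]\!]_{m+1/2}=(\tilde R_{m+1/2}^{d\top})^{-1}(\tilde{\mathcal V}^-_{m+1}-\tilde{\mathcal V}^+_m)$. **Schemes.** With $2p=2$ for O2_ES and $2p=4$ for O3_ES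 and O4_ES let $$\hat F^d_{m+1/2}=\tilde F^{d,2p}_{m+1/2}-\tfrac12\mathbf D^d_{m+1/2}[\![\tilde V]\!]_{m+1/2},\qquad \hat q^d_{m+1/2}=\tilde q^{d,2p}_{m+1/2}-\tfrac12\bar V_{m+1/2}^\top\mathbf D^d_{m+1/2}[\![\tilde V]\!]_{m+1/2},$$ where $\bar V_{m+1/2}=\frac12(V_m+V_{m+1})$. The scheme at a cell $(i,j)$ is $$\frac{d}{dt}U_{i,j}+\frac{\hat F^x_{i+1/2,j}-\hat F^x_{i-1/2,j}}{\Delta x}+\frac{\hat F^y_{i,j+1/2}-\hat F^y_{i,j-1/2}}{\Delta y}+B^x(U_{i,j})(\partial_xh)_{i,j}+B^y(U_{i,j})(\partial_yh)_{i,j}=0,$$ where $(\partial_xh)_{i,j},(\partial_yh)_{i,j}$ are the standard central differences, of second order for O2_ES and of fourth order for O3_ES and O4_ES. **Theorem.** The semi-discrete schemes O2_ES, O3_ES and O4_ES are entropy stable. That is: the numerical entropy fluxes $\hat q^x,\hat q^y$ are consistent (on a constant grid function with value $U\in\Omega$ they equal $q^x(U)$ and $q^y(U)$), and whenever $U_{i,j}(t)$,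 $(i,j)\in\mathbb Z^2$, has values in $\Omega$ for all $t$ in a set $I$ of times and satisfies the scheme on $I$ at the cells $(i,j)$ of a set $C$ (the other values being arbitrary ghost values in $\Omega$), then for all $t\in I$ and $(i,j)\in C$ $$\frac{d}{dt}\eta(U_{i,j})+\frac1{\Delta x}\big(\hat q^x_{i+1/2,j}-\hat q^x_{i-1/2,j}\big)+\frac1{\Delta y}\big(\hat q^y_{i,j+1/2}-\hat q^y_{i,j-1/2}\big)\le0 .$$ (Time derivatives are taken within $I$; the derivative of $\eta(U_{i,j})$ exists.) -/

import Mathlib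

noncomputable section

namespace ShearShallowWater

open Matrix

/-- Vectors of conserved variables `U = (h, h v₁, h v₂, E₁₁, E₁₂, E₂₂)`. -/
abbrev State : Type := Fin 6 → ℝ

/-- The two coordinate directions. -/
inductive Dir
  | x
  | y

/-! ### The shear shallow water model -/

/-- Water depth. -/
def depth (U : State) : ℝ := U 0

/-- First velocity component. -/
def v1 (U : State) : ℝ := U 1 / U 0

/-- Second velocity component. -/
def v2 (U : State) : ℝ := U 2 / U 0

/-- The stress component `P₁₁`, from the equation of state `E = (h / 2) (v ⊗ v + P)`. -/
def p11 (U : State) : ℝ := 2 * U 3 / U 0 - v1 U ^ 2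

/-- The stress component `P₁₂ = P₂₁`. -/
def p12 (U : State) : ℝ := 2 * U 4 / U 0 - v1 U * v2 U

/-- The stress component `P₂₂`. -/
def p22 (U : State) : ℝ := 2 * U 5 / U 0 - v2 U ^ 2

/-- The symmetric stress tensor. -/
def stress (U : State) : Matrix (Fin 2) (Fin 2) ℝ := !![p11 U, p12 U; p12 U, p22 U]

/-- `det P`. -/
def detP (U : State) : ℝ := p11 U * p22 U - p12 U ^ 2

/-- The set `Ω` of physically admissible states: positive depth, positive definite stress. -/
def admissible : Set State :=
  {U | 0 < depth U ∧ ∀ z : Fin 2 → ℝ, z ≠ 0 → 0 < z ⬝ᵥ (stress U *ᵥ z)}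

/-- The velocity component in the direction `d`. -/
def vel : Dir → State → ℝ
  | .x => v1
  | .y => v2

/-- The diagonal stress component in the direction `d`. -/
def pdd : Dir → State → ℝ
  | .x => p11
  | .y => p22

/-- The fluxes `F^x` and `F^y` of the conservative part. -/
def flux : Dir → State → State
  | .x, U =>
    ![depth U * v1 U,
      depth U * (v1 U ^ 2 + p11 U),
      depth U * (v1 U * v2 U + p12 U),
      1 / 2 * depth U * v1 U * (v1 U ^ 2 + 3 * p11 U),
      1 / 2 * depth U * (v1 U ^ 2 * v2 U + 2 * v1 U * p12 U + v2 U * p11 U),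
      1 / 2 * depth U * (v1 U * v2 U ^ 2 + 2 * v2 U * p12 U + v1 U * p22 U)]
  | .y, U =>
    ![depth U * v2 U,
      depth U * (v1 U * v2 U + p12 U),
      depth U * (v2 U ^ 2 + p22 U),
      1 / 2 * depth U * (v1 U ^ 2 * v2 U + 2 * v1 U * p12 U + v2 U * p11 U),
      1 / 2 * depth U * (v1 U * v2 U ^ 2 + 2 * v2 U * p12 U + v1 U * p22 U),
      1 / 2 * depth U * (v2 U ^ 3 + 3 * v2 U * p22 U)]

/-- The coefficients `B^x`, `B^y` of the non-conservative terms `B^x ∂h/∂x`, `B^y ∂h/∂y`. -/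
def nonconsCoeff (g : ℝ) : Dir → State → State
  | .x, U =>
    ![0, g * depth U, 0, g * depth U * v1 U, 1 / 2 * g * depth U * v2 U, 0]
  | .y, U =>
    ![0, 0, g * depth U, 0, 1 / 2 * g * depth U * v1 U, g * depth U * v2 U]

/-! ### Entropy, entropy fluxes, entropy variables and potentials -/

/-- `s = log (det P / h²)`. -/
def specificEntropy (U : State) : ℝ := Real.log (detP U / depth U ^ 2)

/-- The entropy `η = - h s`. -/
def entropy (U : State) : ℝ := -(depth U * specificEntropy U)

/-- The entropy fluxes `q^x = - h v₁ s`, `q^y = - h v₂ s`. -/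
def entropyFlux (d : Dir) (U : State) : ℝ := -(depth U * vel d U * specificEntropy U)

/-- The entropy variables `V = ∂η/∂U`. -/
def entropyVar (U : State) : State := fun k => fderiv ℝ entropy U (Pi.single k 1)

/-- The entropy potentials `ψ^d = Vᵀ F^d - q^d`. -/
def potential (d : Dir) (U : State) : ℝ := entropyVar U ⬝ᵥ flux d U - entropyFlux d U

/-! ### Entropy conservative fluxes -/

/-- Arithmetic average. -/
def avg (a b : ℝ) : ℝ := (a + b) / 2

/-- Logarithmic average `⟦a⟧ / ⟦ln a⟧`, extended by `a` to two equal arguments. -/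
def logAvg (a b : ℝ) : ℝ := if a = b then a else (b - a) / (Real.log b - Real.log a)

/-- `β₁₁ = P₁₁ / det P`. -/
def beta11 (U : State) : ℝ := p11 U / detP U

/-- `β₁₂ = P₁₂ / det P`. -/
def beta12 (U : State) : ℝ := p12 U / detP U

/-- `β₂₂ = P₂₂ / det P`. -/
def beta22 (U : State) : ℝ := p22 U / detP U

/-- `D_β = β₁₁ β₂₂ - β₁₂²`. -/
def detBeta (U : State) : ℝ := beta11 U * beta22 U - beta12 U ^ 2

/-- First component of the two-point flux: `h^ln` times the averaged normal velocity. -/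
def ecMass (d : Dir) (L R : State) : ℝ :=
  logAvg (depth L) (depth R) * avg (vel d L) (vel d R)

/-- `h̄ / (β̄₁₁ β̄₂₂ - β̄₁₂²)`. -/
def ecPressure (L R : State) : ℝ :=
  avg (depth L) (depth R) /
    (avg (beta11 L) (beta11 R) * avg (beta22 L) (beta22 R) - avg (beta12 L) (beta12 R) ^ 2)

/-- Second component of the two-point flux. -/
def ecMom1 (d : Dir) (L R : State) : ℝ :=
  avg (v1 L) (v1 R) * ecMass d L R +
    (match d with
      | .x => avg (beta11 L) (beta11 R)
      | .y => avg (beta12 L) (beta12 R)) * ecPressure L R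

/-- Third component of the two-point flux. -/
def ecMom2 (d : Dir) (L R : State) : ℝ :=
  avg (v2 L) (v2 R) * ecMass d L R +
    (match d with
      | .x => avg (beta12 L) (beta12 R)
      | .y => avg (beta22 L) (beta22 R)) * ecPressure L R

/-- The second order two-point entropy conservative flux `F̃^d(L, R)`. -/
def ecFlux (d : Dir) (L R : State) : State :=
  ![ecMass d L R,
    ecMom1 d L R,
    ecMom2 d L R,
    1 / 2 * (avg (beta11 L) (beta11 R) / logAvg (detBeta L) (detBeta R)
        - avg (v1 L ^ 2) (v1 R ^ 2)) * ecMass d L R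
      + avg (v1 L) (v1 R) * ecMom1 d L R,
    1 / 2 * ((avg (beta12 L) (beta12 R) / logAvg (detBeta L) (detBeta R)
        - avg (v1 L * v2 L) (v1 R * v2 R)) * ecMass d L R
      + avg (v1 L) (v1 R) * ecMom2 d L R + avg (v2 L) (v2 R) * ecMom1 d L R),
    1 / 2 * (avg (beta22 L) (beta22 R) / logAvg (detBeta L) (detBeta R)
        - avg (v2 L ^ 2) (v2 R ^ 2)) * ecMass d L R
      + avg (v2 L) (v2 R) * ecMom2 d L R]

/-- The entropy flux `q̃^d = V̄ᵀ F̃^d - ψ̄^d` that goes with the two-point flux. -/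
def ecEntropyFlux (d : Dir) (L R : State) : ℝ :=
  ((1 / 2 : ℝ) • (entropyVar L + entropyVar R)) ⬝ᵥ ecFlux d L R
    - avg (potential d L) (potential d R)

/-! ### Entropy scaled eigenvectors and eigenvalues of `∂F^d/∂U` -/

/-- The Jacobian `∂U/∂W` with respect to the primitive variables
`W = (h, v₁, v₂, P₁₁, P₁₂, P₂₂)`. -/
def primJacobian (U : State) : Matrix (Fin 6) (Fin 6) ℝ :=
  !![1, 0, 0, 0, 0, 0;
     v1 U, depth U, 0, 0, 0, 0;
     v2 U, 0, depth U, 0, 0, 0;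
     1 / 2 * (p11 U + v1 U ^ 2), depth U * v1 U, 0, depth U / 2, 0, 0;
     1 / 2 * (p12 U + v1 U * v2 U), depth U * v2 U / 2, depth U * v1 U / 2, 0, depth U / 2, 0;
     1 / 2 * (p22 U + v2 U ^ 2), 0, depth U * v2 U, 0, 0, depth U / 2]

/-- Right eigenvectors (columns) of the flux Jacobian in primitive variables. -/
def eigvecPrim : Dir → State → Matrix (Fin 6) (Fin 6) ℝ
  | .x, U =>
    !![depth U * p11 U, 0, -depth U, 0, 0, depth U * p11 U;
       -(√(3 * p11 U) * p11 U), 0, 0, 0, 0, √(3 * p11 U) * p11 U;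
       -(√(3 * p11 U) * p12 U), -√(p11 U), 0, 0, √(p11 U), √(3 * p11 U) * p12 U;
       2 * p11 U ^ 2, 0, p11 U, 0, 0, 2 * p11 U ^ 2;
       2 * p11 U * p12 U, p11 U, p12 U, 0, p11 U, 2 * p11 U * p12 U;
       2 * p12 U ^ 2, 2 * p12 U, 0, 1, 2 * p12 U, 2 * p12 U ^ 2]
  | .y, U =>
    !![depth U * p22 U, 0, -depth U, 0, 0, depth U * p22 U;
       -(√(3 * p22 U) * p12 U), -√(p22 U), 0, 0, √(p22 U), √(3 * p22 U) * p12 U;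
       -(√(3 * p22 U) * p22 U), 0, 0, 0, 0, √(3 * p22 U) * p22 U;
       2 * p12 U ^ 2, 2 * p12 U, 0, 1, 2 * p12 U, 2 * p12 U ^ 2;
       2 * p22 U * p12 U, p22 U, p12 U, 0, p22 U, 2 * p22 U * p12 U;
       2 * p22 U ^ 2, 0, p22 U, 0, 0, 2 * p22 U ^ 2]

/-- `r = det P / (√3 h P_dd)`. -/
def scaleR (d : Dir) (U : State) : ℝ := detP U / (√3 * depth U * pdd d U)

/-- `α = √(((√3 det P + P_dd)² + P₁₂⁴) / (3 h P_dd²))`. -/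
def scaleAlpha (d : Dir) (U : State) : ℝ :=
  √(((√3 * detP U + pdd d U) ^ 2 + p12 U ^ 4) / (3 * depth U * pdd d U ^ 2))

/-- The scaling matrix `T^d`. -/
def scaling (d : Dir) (U : State) : Matrix (Fin 6) (Fin 6) ℝ :=
  let a := √(1 / (12 * depth U * pdd d U ^ 2))
  let b := √(detP U / (4 * depth U * pdd d U ^ 2))
  let t33 := (1 / (3 * depth U) + scaleR d U) / scaleAlpha d U
  let t34 := p12 U ^ 2 / (3 * depth U * pdd d U * scaleAlpha d U)
  let t44 := (√3 * detP U * (√3 * detP U + pdd d U) + p12 U ^ 4) /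
    (3 * depth U * pdd d U ^ 2 * scaleAlpha d U)
  !![a, 0, 0, 0, 0, 0;
     0, b, 0, 0, 0, 0;
     0, 0, t33, t34, 0, 0;
     0, 0, t34, t44, 0, 0;
     0, 0, 0, 0, b, 0;
     0, 0, 0, 0, 0, a]

/-- The entropy scaled right eigenvector matrix `R̃^d = (∂U/∂W) R_W^d T^d`. -/
def scaledEigvec (d : Dir) (U : State) : Matrix (Fin 6) (Fin 6) ℝ :=
  primJacobian U * eigvecPrim d U * scaling d U

/-- The eigenvalues of the flux Jacobian `∂F^d/∂U`. -/
def eigval (d : Dir) (U : State) : Fin 6 → ℝ :=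
  ![vel d U - √(3 * pdd d U), vel d U - √(pdd d U), vel d U, vel d U,
    vel d U + √(pdd d U), vel d U + √(3 * pdd d U)]

/-- `max_k |λ_k^d|`. -/
def maxSpeed (d : Dir) (U : State) : ℝ :=
  Finset.univ.sup' ⟨0, Finset.mem_univ _⟩ (fun k => |eigval d U k|)

/-! ### Sign preserving reconstructions of scalar grid functions

A grid function is `u : ℤ → ℝ`; the (uniform) mesh size is normalized to one, the `i`-th node is
the point `i`, and the `i`-th cell is `[i - 1/2, i + 1/2]`. -/

/-- The minmod function. -/
def minmod (a b : ℝ) : ℝ :=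
  if 0 < a ∧ 0 < b then min a b else if a < 0 ∧ b < 0 then max a b else 0

/-- Undivided differences: `undivDiff u n m` is the `n`-th difference on the nodes `m, …, m + n`. -/
def undivDiff (u : ℤ → ℝ) : ℕ → ℤ → ℝ
  | 0, m => u m
  | n + 1, m => undivDiff u n (m + 1) - undivDiff u n m

/-- Left end of the ENO stencil with `n + 1` cells that belongs to cell `i`: starting from `{i}`,
the stencil grows by one cell at a time, to the side with the smaller difference. -/
def enoStart (u : ℤ → ℝ) (i : ℤ) : ℕ → ℤ
  | 0 => i
  | n + 1 =>
    if |undivDiff u (n + 1) (enoStart u i n - 1)| < |undivDiff u (n + 1) (enoStart u i n)|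
    then enoStart u i n - 1
    else enoStart u i n

/-- The two usual ENO procedures: reconstruction from cell averages, and interpolation of point
values. -/
inductive EnoKind
  | cellAverages
  | pointValues

/-- The polynomial of degree less than `k` fitted to `u` on the cells `s, …, s + k - 1`. For cell
averages it is the derivative of the polynomial that interpolates the primitive function at the
cell interfaces. -/
def fitPoly : EnoKind → ℕ → (ℤ → ℝ) → ℤ → Polynomial ℝ
  | .cellAverages, k, u, s =>
    Polynomial.derivative (Lagrange.interpolate (Finset.range (k + 1))
      (fun j : ℕ => (s : ℝ) + (j : ℝ) - 1 / 2)
      (fun j : ℕ => ∑ l ∈ Finset.range j, u (s + (l : ℤ))))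
  | .pointValues, k, u, s =>
    Lagrange.interpolate (Finset.range k)
      (fun j : ℕ => (s : ℝ) + (j : ℝ)) (fun j : ℕ => u (s + (j : ℤ)))

/-- The value at the point `ξ` of the `k`-th order ENO polynomial of cell `i`. -/
def enoValue (e : EnoKind) (k : ℕ) (u : ℤ → ℝ) (i : ℤ) (ξ : ℝ) : ℝ :=
  (fitPoly e k u (enoStart u i (k - 1))).eval ξ

/-- The three schemes. -/
inductive Order
  | O2
  | O3
  | O4

/-- The value at `ξ` of the reconstruction in cell `i`: minmod for O2, third order ENO for O3,
fourth order ENO for O4. -/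
def reconstruct : Order → EnoKind → (ℤ → ℝ) → ℤ → ℝ → ℝ
  | .O2, _, u, i, ξ => u i + minmod (u i - u (i - 1)) (u (i + 1) - u i) * (ξ - (i : ℝ))
  | .O3, e, u, i, ξ => enoValue e 3 u i ξ
  | .O4, e, u, i, ξ => enoValue e 4 u i ξ

/-! ### The entropy stable fluxes

A grid line is `c : ℤ → State`; its interface number `m` is `m + 1/2`, between cells `m`, `m + 1`. -/

/-- The two usual ways to scale the entropy variables around the interface `m + 1/2`: with the
matrix of this interface everywhere, or each jump with the matrix of its own interface. -/
inductive Scaling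
  | frozen
  | jumpwise

/-- The choices that specify one of the schemes. `eigState d L R` and `speedState d L R` are the
states at which the eigenvectors and the maximal wave speed are evaluated at an interface in the
direction `d` with adjacent cell values `L` and `R`. -/
structure SchemeData where
  order : Order
  eno : EnoKind
  scaling : Scaling
  eigState : Dir → State → State → State
  speedState : Dir → State → State → State

/-- The interface states are admissible whenever the adjacent cell values are. -/
def SchemeData.WellPosed (S : SchemeData) : Prop :=
  ∀ d : Dir, ∀ L ∈ admissible, ∀ R ∈ admissible,
    S.eigState d L R ∈ admissible ∧ S.speedState d L R ∈ admissible

/-- `R̃` at the interface `m + 1/2`. -/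
def faceEigvec (S : SchemeData) (d : Dir) (c : ℤ → State) (m : ℤ) : Matrix (Fin 6) (Fin 6) ℝ :=
  scaledEigvec d (S.eigState d (c m) (c (m + 1)))

/-- `Λ = max_k |λ_k| I` at the interface `m + 1/2`. -/
def faceLambda (S : SchemeData) (d : Dir) (c : ℤ → State) (m : ℤ) : Matrix (Fin 6) (Fin 6) ℝ :=
  Matrix.diagonal (fun _ => maxSpeed d (S.speedState d (c m) (c (m + 1))))

/-- The Rusanov type diffusion matrix `R̃ Λ R̃ᵀ` at the interface `m + 1/2`. -/
def faceDiffusion (S : SchemeData) (d : Dir) (c : ℤ → State) (m : ℤ) :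
    Matrix (Fin 6) (Fin 6) ℝ :=
  faceEigvec S d c m * faceLambda S d c m * (faceEigvec S d c m)ᵀ

/-- The scaled entropy variables that are reconstructed at the interface `m + 1/2`. In both cases
the values at `m` and `m + 1` are `R̃ᵀ V_m` and `R̃ᵀ V_{m+1}` with `R̃` at `m + 1/2`; in the
jumpwise case the jump at each interface `k + 1/2` is scaled by the matrix of that interface. -/
def scaledVar (S : SchemeData) (d : Dir) (c : ℤ → State) (m : ℤ) : ℤ → State :=
  match S.scaling with
  | .frozen => fun l => (faceEigvec S d c m)ᵀ *ᵥ entropyVar (c l)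
  | .jumpwise => fun l =>
      (faceEigvec S d c m)ᵀ *ᵥ entropyVar (c m)
        + ∑ k ∈ Finset.Ico m l,
            (faceEigvec S d c k)ᵀ *ᵥ (entropyVar (c (k + 1)) - entropyVar (c k))
        - ∑ k ∈ Finset.Ico l m,
            (faceEigvec S d c k)ᵀ *ᵥ (entropyVar (c (k + 1)) - entropyVar (c k))

/-- Reconstructed scaled variables at `m + 1/2` from cell `i` (with `i = m` or `i = m + 1`). -/
def scaledTrace (S : SchemeData) (d : Dir) (c : ℤ → State) (m i : ℤ) : State :=
  fun k => reconstruct S.order S.eno (fun l => scaledVar S d c m l k) i ((m : ℝ) + 1 / 2)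

/-- Reconstructed entropy variables `(R̃ᵀ)⁻¹ 𝒱̃` at `m + 1/2` from cell `i`. -/
def entropyVarTrace (S : SchemeData) (d : Dir) (c : ℤ → State) (m i : ℤ) : State :=
  ((faceEigvec S d c m)ᵀ)⁻¹ *ᵥ scaledTrace S d c m i

/-- The jump `⟦Ṽ⟧ = Ṽ⁻_{m+1} - Ṽ⁺_m` of the reconstructed entropy variables at `m + 1/2`. -/
def reconstructedJump (S : SchemeData) (d : Dir) (c : ℤ → State) (m : ℤ) : State :=
  entropyVarTrace S d c m (m + 1) - entropyVarTrace S d c m m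

/-- The entropy conservative flux at `m + 1/2`: second order for O2, fourth order for O3, O4. -/
def lineEcFlux (o : Order) (d : Dir) (c : ℤ → State) (m : ℤ) : State :=
  match o with
  | .O2 => ecFlux d (c m) (c (m + 1))
  | .O3 | .O4 =>
    (4 / 3 : ℝ) • ecFlux d (c m) (c (m + 1))
      - (1 / 6 : ℝ) • (ecFlux d (c (m - 1)) (c (m + 1)) + ecFlux d (c m) (c (m + 2)))

/-- The entropy flux that goes with `lineEcFlux`. -/
def lineEcEntropyFlux (o : Order) (d : Dir) (c : ℤ → State) (m : ℤ) : ℝ :=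
  match o with
  | .O2 => ecEntropyFlux d (c m) (c (m + 1))
  | .O3 | .O4 =>
    4 / 3 * ecEntropyFlux d (c m) (c (m + 1))
      - 1 / 6 * (ecEntropyFlux d (c (m - 1)) (c (m + 1)) + ecEntropyFlux d (c m) (c (m + 2)))

/-- The entropy stable numerical flux `F̂ = F̃ - ½ D ⟦Ṽ⟧` at `m + 1/2`. -/
def esFlux (S : SchemeData) (d : Dir) (c : ℤ → State) (m : ℤ) : State :=
  lineEcFlux S.order d c m
    - (1 / 2 : ℝ) • (faceDiffusion S d c m *ᵥ reconstructedJump S d c m)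

/-- The numerical entropy flux `q̂ = q̃ - ½ V̄ᵀ D ⟦Ṽ⟧` at `m + 1/2`. -/
def esEntropyFlux (S : SchemeData) (d : Dir) (c : ℤ → State) (m : ℤ) : ℝ :=
  lineEcEntropyFlux S.order d c m
    - 1 / 2 * (((1 / 2 : ℝ) • (entropyVar (c m) + entropyVar (c (m + 1))))
        ⬝ᵥ (faceDiffusion S d c m *ᵥ reconstructedJump S d c m))

/-! ### The semi-discrete schemes -/

/-- Central difference approximation of a derivative on a grid with mesh size `δ`: second order
for O2, fourth order for O3 and O4. -/
def centralDiff (o : Order) (δ : ℝ) (f : ℤ → ℝ) (m : ℤ) : ℝ :=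
  match o with
  | .O2 => (f (m + 1) - f (m - 1)) / (2 * δ)
  | .O3 | .O4 => (-f (m + 2) + 8 * f (m + 1) - 8 * f (m - 1) + f (m - 2)) / (12 * δ)

/-- The grid line through the cell `(i, j)` in the direction `x`. -/
def lineX (G : ℤ → ℤ → State) (j : ℤ) : ℤ → State := fun m => G m j

/-- The grid line through the cell `(i, j)` in the direction `y`. -/
def lineY (G : ℤ → ℤ → State) (i : ℤ) : ℤ → State := fun m => G i m

/-- The non-conservative term `B^x(U_ij) (∂h/∂x)_ij + B^y(U_ij) (∂h/∂y)_ij`. -/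
def nonconsTerm (o : Order) (g Δx Δy : ℝ) (G : ℤ → ℤ → State) (i j : ℤ) : State :=
  centralDiff o Δx (fun m => depth (lineX G j m)) i • nonconsCoeff g .x (G i j)
    + centralDiff o Δy (fun m => depth (lineY G i m)) j • nonconsCoeff g .y (G i j)

/-- `- dU_ij/dt` in the semi-discrete scheme without source terms. -/
def schemeResidual (S : SchemeData) (g Δx Δy : ℝ) (G : ℤ → ℤ → State) (i j : ℤ) : State :=
  (1 / Δx) • (esFlux S .x (lineX G j) i - esFlux S .x (lineX G j) (i - 1))
    + (1 / Δy) • (esFlux S .y (lineY G i) j - esFlux S .y (lineY G i) (j - 1))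
    + nonconsTerm S.order g Δx Δy G i j

/-- `U` solves the semi-discrete scheme on the cells in `C` for times in `I`. All values are
admissible; those outside `C` are ghost values, on which nothing else is imposed. -/
structure IsSolution (S : SchemeData) (g Δx Δy : ℝ) (I : Set ℝ) (C : Set (ℤ × ℤ))
    (U : ℝ → ℤ → ℤ → State) : Prop where
  mem_admissible : ∀ t ∈ I, ∀ i j : ℤ, U t i j ∈ admissible
  scheme : ∀ t ∈ I, ∀ i j : ℤ, (i, j) ∈ C →
    HasDerivWithinAt (fun τ => U τ i j) (-schemeResidual S g Δx Δy (U t) i j) I t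

end ShearShallowWater

end

noncomputable section

namespace ShearShallowWater

open Matrix

/-! ### Admissible states, entropy variables and potentials -/

/-! Pair the scheme with `V = ∂η/∂U`. The chain rule turns the time derivative into that of `η`, and
the non-conservative terms drop out because `V` is orthogonal to `B^x` and `B^y`.

For the conservative part, Tadmor's condition `⟦V⟧ ⬝ F̃ = ⟦ψ⟧` (`ecFlux_entropy_conservative`) makes
`V_m` times the flux difference telescope into a difference of `q̃`, also for the fourth order
combination (`dotProduct_lineEcFlux_sub`).

What remains is a quarter of `⟦V⟧ ⬝ D ⟦Ṽ⟧` at the two interfaces of the cell. With `D = R̃ Λ R̃ᵀ`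
and `Λ` a nonnegative multiple of the identity, this is a nonnegative multiple of the scalar product
of the jump of the scaled variables with the jump of their reconstruction. Each component has the
right sign by the sign property (`reconstruct_jump_mul_nonneg`). Of `R̃` only the invertibility
matters, not that its columns are eigenvectors.

The sign property of ENO rests on two facts. Moving a stencil by one cell changes the interface
value by an undivided difference times a factor of known alternating sign
(`exists_eval_fitPoly_succ_sub`). The differences met between the stencils of two neighbouring cells
alternate in sign as well (`enoStart_alternating`). Hence all terms of the telescoping sum carry the
sign of the jump. -/

theorem p11_pos {U : State} (hU : U ∈ admissible) : 0 < p11 U := by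
  simpa [stress, Matrix.mulVec, dotProduct, Fin.sum_univ_two] using hU.2 ![1, 0] (by simp)

theorem p22_pos {U : State} (hU : U ∈ admissible) : 0 < p22 U := by
  simpa [stress, Matrix.mulVec, dotProduct, Fin.sum_univ_two] using hU.2 ![0, 1] (by simp)

theorem pdd_pos (d : Dir) {U : State} (hU : U ∈ admissible) : 0 < pdd d U := by
  cases d
  exacts [p11_pos hU, p22_pos hU]

theorem detP_pos {U : State} (hU : U ∈ admissible) : 0 < detP U := by
  have h1 := p11_pos hU
  have h := hU.2 ![-p12 U, p11 U] (fun h => h1.ne' (by simpa using congrFun h 1))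
  simp [stress, Matrix.mulVec, dotProduct, Fin.sum_univ_two] at h
  unfold detP
  refine pos_of_mul_pos_left (b := p11 U) ?_ h1.le
  linarith

theorem hasFDerivAt_entropy {U : State} (hU : U ∈ admissible) :
    HasFDerivAt entropy (fderiv ℝ entropy U) U := by
  have h0 : U 0 ≠ 0 := hU.1.ne'
  have hD : (2 * U 3 / U 0 - (U 1 / U 0) ^ 2) * (2 * U 5 / U 0 - (U 2 / U 0) ^ 2)
      - (2 * U 4 / U 0 - U 1 / U 0 * (U 2 / U 0)) ^ 2 ≠ 0 := (detP_pos hU).ne'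
  refine DifferentiableAt.hasFDerivAt ?_
  unfold entropy specificEntropy detP p11 p12 p22 v1 v2 depth
  fun_prop (disch := first | assumption | positivity)

/-- The entropy variables in terms of the primitive variables. -/
def entropyVarPrim (U : State) : State :=
  ![4 - specificEntropy U - (beta22 U * v1 U ^ 2 - 2 * beta12 U * v1 U * v2 U
      + beta11 U * v2 U ^ 2),
    2 * beta22 U * v1 U - 2 * beta12 U * v2 U,
    2 * beta11 U * v2 U - 2 * beta12 U * v1 U,
    -2 * beta22 U, 4 * beta12 U, -2 * beta11 U]

/-- Along the line `t ↦ U + t w` everything is a function of one real variable; its derivative at 0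
is computed by the calculus rules and identified with the directional derivative by uniqueness. -/
theorem fderiv_entropy_apply {U : State} (hU : U ∈ admissible) (w : State) :
    fderiv ℝ entropy U w = entropyVarPrim U ⬝ᵥ w := by
  have h0 : U 0 ≠ 0 := hU.1.ne'
  have hD' : detP U ≠ 0 := (detP_pos hU).ne'
  set L : ℝ → State := fun t => U + t • w
  have hL : HasDerivAt L w 0 := by
    simpa [L] using ((hasDerivAt_id (0 : ℝ)).smul_const w)
  have hL0 : L 0 = U := by simp [L]
  have hc : ∀ k : Fin 6, HasDerivAt (fun t => L t k) (w k) 0 := hasDerivAt_pi.mp hL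
  have h0' : L 0 0 ≠ 0 := by rwa [hL0]
  have hv1 := (hc 1).div (hc 0) h0'
  have hv2 := (hc 2).div (hc 0) h0'
  have hp11 := (((hc 3).const_mul 2).div (hc 0) h0').sub (hv1.pow 2)
  have hp12 := (((hc 4).const_mul 2).div (hc 0) h0').sub (hv1.mul hv2)
  have hp22 := (((hc 5).const_mul 2).div (hc 0) h0').sub (hv2.pow 2)
  have hdet := (hp11.mul hp22).sub (hp12.pow 2)
  have hD : detP (L 0) ≠ 0 := by rwa [hL0]
  have hs := (hdet.div ((hc 0).pow 2) (pow_ne_zero 2 h0')).log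
    (div_ne_zero hD (pow_ne_zero 2 h0'))
  have hη : HasDerivAt (entropy ∘ L) _ 0 := ((hc 0).mul hs).neg
  have hcomp : HasDerivAt (entropy ∘ L) (fderiv ℝ entropy U w) 0 := by
    refine HasFDerivAt.comp_hasDerivAt 0 ?_ hL
    rw [hL0]
    exact hasFDerivAt_entropy hU
  rw [hcomp.unique hη]
  simp only [Pi.div_apply, Pi.mul_apply, Pi.sub_apply, Pi.pow_apply, hL0]
  have e1 : U 1 / U 0 = v1 U := rfl
  have e2 : U 2 / U 0 = v2 U := rfl
  have e3 : 2 * U 3 / U 0 - v1 U ^ 2 = p11 U := by rfl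
  have e4 : 2 * U 4 / U 0 - v1 U * v2 U = p12 U := by rfl
  have e5 : 2 * U 5 / U 0 - v2 U ^ 2 = p22 U := by rfl
  simp only [e1, e2, e3, e4, e5]
  -- Trading the conserved variables for the primitive ones leaves a rational identity with
  -- denominators `h` and `det P` only.
  have f1 : U 1 = U 0 * v1 U := by rw [← e1]; field_simp
  have f2 : U 2 = U 0 * v2 U := by rw [← e2]; field_simp
  have f3 : U 3 = U 0 / 2 * (p11 U + v1 U ^ 2) := by rw [← e3]; field_simp; ring
  have f4 : U 4 = U 0 / 2 * (p12 U + v1 U * v2 U) := by rw [← e4]; field_simp; ring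
  have f5 : U 5 = U 0 / 2 * (p22 U + v2 U ^ 2) := by rw [← e5]; field_simp; ring
  have e6 : Real.log ((p11 U * p22 U - p12 U ^ 2) / U 0 ^ 2) = specificEntropy U := rfl
  rw [e6, f1, f2, f3, f4, f5]
  simp only [entropyVarPrim, beta11, beta12, beta22, dotProduct, Fin.sum_univ_six,
    Matrix.cons_val]
  unfold detP at hD' ⊢
  generalize U 0 = h at *
  generalize v1 U = a at *
  generalize v2 U = b at *
  generalize p11 U = p at *
  generalize p12 U = q at *
  generalize p22 U = r at *
  generalize specificEntropy U = σ at *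
  clear * - h0 hD'
  norm_num
  field_simp
  ring

theorem entropyVar_eq {U : State} (hU : U ∈ admissible) : entropyVar U = entropyVarPrim U := by
  funext k
  rw [entropyVar, fderiv_entropy_apply hU, dotProduct_single, mul_one]

theorem dotProduct_nonconsCoeff (g : ℝ) (d : Dir) {U : State} (hU : U ∈ admissible) :
    entropyVar U ⬝ᵥ nonconsCoeff g d U = 0 := by
  rw [entropyVar_eq hU]
  cases d <;>
  · simp only [entropyVarPrim, nonconsCoeff, dotProduct, Fin.sum_univ_six, Matrix.cons_val]
    ring

theorem potential_eq (d : Dir) {U : State} (hU : U ∈ admissible) :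
    potential d U = 2 * depth U * vel d U := by
  have hD := (detP_pos hU).ne'
  rw [potential, entropyVar_eq hU]
  cases d <;>
  · simp only [entropyVarPrim, flux, entropyFlux, vel, dotProduct, Fin.sum_univ_six,
      Matrix.cons_val, beta11, beta12, beta22]
    field_simp
    unfold detP
    ring

theorem detBeta_eq {U : State} (hU : U ∈ admissible) : detBeta U = (detP U)⁻¹ := by
  have hD := (detP_pos hU).ne'
  unfold detBeta beta11 beta12 beta22
  field_simp
  rfl

theorem detBeta_pos {U : State} (hU : U ∈ admissible) : 0 < detBeta U := by
  rw [detBeta_eq hU]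
  exact inv_pos.mpr (detP_pos hU)

theorem specificEntropy_eq {U : State} (hU : U ∈ admissible) :
    specificEntropy U = -(Real.log (detBeta U) + 2 * Real.log (depth U)) := by
  rw [specificEntropy, Real.log_div (detP_pos hU).ne' (pow_ne_zero 2 hU.1.ne'), Real.log_pow,
    detBeta_eq hU, Real.log_inv]
  push_cast
  ring

/-! ### The entropy conservative fluxes -/

theorem logAvg_self (a : ℝ) : logAvg a a = a := if_pos rfl

theorem logAvg_pos {a b : ℝ} (ha : 0 < a) (hb : 0 < b) : 0 < logAvg a b := by
  unfold logAvg
  split_ifs with h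
  · exact ha
  · rcases lt_or_gt_of_ne h with h | h
    · exact div_pos (sub_pos.mpr h) (sub_pos.mpr (Real.log_lt_log ha h))
    · exact div_pos_of_neg_of_neg (sub_neg.mpr h) (sub_neg.mpr (Real.log_lt_log hb h))

theorem logAvg_mul_log_sub {a b : ℝ} (ha : 0 < a) (hb : 0 < b) :
    logAvg a b * (Real.log b - Real.log a) = b - a := by
  unfold logAvg
  split_ifs with h
  · simp [h]
  · have : Real.log b - Real.log a ≠ 0 := fun h' =>
      h (Real.log_injOn_pos ha hb (sub_eq_zero.mp h').symm)
    field_simp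

theorem avg_self (a : ℝ) : avg a a = a := by simp [avg]

/-- Convexity of the cone of positive definite 2×2 matrices; it keeps the denominator of
`ecPressure` away from zero. The mixed term is positive because `a₁ a₂ (a₁ c₂ + a₂ c₁ - 2 b₁ b₂)`
equals `a₁²` and `a₂²` times the opposite determinants plus the square of `a₁ b₂ - a₂ b₁`. -/
theorem avg_det_pos {a₁ b₁ c₁ a₂ b₂ c₂ : ℝ} (ha₁ : 0 < a₁) (ha₂ : 0 < a₂)
    (h₁ : 0 < a₁ * c₁ - b₁ ^ 2) (h₂ : 0 < a₂ * c₂ - b₂ ^ 2) :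
    0 < avg a₁ a₂ * avg c₁ c₂ - avg b₁ b₂ ^ 2 := by
  have h : 0 < a₁ * a₂ * (a₁ * c₂ + a₂ * c₁ - 2 * b₁ * b₂) := by
    nlinarith [mul_pos (pow_pos ha₁ 2) h₂, mul_pos (pow_pos ha₂ 2) h₁, sq_nonneg (a₁ * b₂ - a₂ * b₁)]
  have := pos_of_mul_pos_right h (mul_pos ha₁ ha₂).le
  unfold avg
  nlinarith

theorem avg_detBeta_pos {L R : State} (hL : L ∈ admissible) (hR : R ∈ admissible) :
    0 < avg (beta11 L) (beta11 R) * avg (beta22 L) (beta22 R)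
      - avg (beta12 L) (beta12 R) ^ 2 :=
  avg_det_pos (div_pos (p11_pos hL) (detP_pos hL)) (div_pos (p11_pos hR) (detP_pos hR))
    (detBeta_pos hL) (detBeta_pos hR)

/-- The two-point flux is entropy conservative. -/
theorem ecFlux_entropy_conservative (d : Dir) {L R : State} (hL : L ∈ admissible)
    (hR : R ∈ admissible) :
    (entropyVar R - entropyVar L) ⬝ᵥ ecFlux d L R = potential d R - potential d L := by
  rw [potential_eq d hL, potential_eq d hR, entropyVar_eq hL, entropyVar_eq hR]
  have hh := logAvg_mul_log_sub hL.1 hR.1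
  have hβ := logAvg_mul_log_sub (detBeta_pos hL) (detBeta_pos hR)
  have hβ0 := (logAvg_pos (detBeta_pos hL) (detBeta_pos hR)).ne'
  have hπ : ecPressure L R * _ = avg (depth L) (depth R) :=
    div_mul_cancel₀ _ (avg_detBeta_pos hL hR).ne'
  have hlog : Real.log (detBeta R) - Real.log (detBeta L) =
      (detBeta R - detBeta L) * (logAvg (detBeta L) (detBeta R))⁻¹ := by
    rw [← hβ]; field_simp
  clear hβ hβ0
  cases d
  all_goals
    simp only [entropyVarPrim, ecFlux, ecMom1, ecMom2, ecMass, vel, dotProduct, Fin.sum_univ_six,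
      Matrix.cons_val, Pi.sub_apply, specificEntropy_eq hL, specificEntropy_eq hR]
    simp only [div_eq_mul_inv _ (logAvg (detBeta L) (detBeta R))]
    generalize ecPressure L R = π at *
    generalize (logAvg (detBeta L) (detBeta R))⁻¹ = X at *
    generalize logAvg (depth L) (depth R) = hln at *
    generalize Real.log (detBeta R) = lbR at *
    generalize Real.log (detBeta L) = lbL at *
    unfold detBeta at hlog
    unfold avg at *
  -- Since `-s = log D_β + 2 log h`, the jump of `log h` against the mass flux gives `2 v̄ ⟦h⟧` and
  -- the pressure terms give `2 h̄ ⟦v⟧`; together they are `⟦2 h v⟧ = ⟦ψ⟧`. The jump of `log D_β`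
  -- cancels the terms with `1 / D_β^ln`.
  · linear_combination (v1 L + v1 R) * hh + hln * (v1 L + v1 R) / 2 * hlog +
      2 * (v1 R - v1 L) * hπ
  · linear_combination (v2 L + v2 R) * hh + hln * (v2 L + v2 R) / 2 * hlog +
      2 * (v2 R - v2 L) * hπ

theorem ecFlux_self (d : Dir) {U : State} (hU : U ∈ admissible) : ecFlux d U U = flux d U := by
  have hD := (detP_pos hU).ne'
  have hπ : ecPressure U U = depth U * detP U := by
    unfold ecPressure
    simp only [avg_self]
    rw [show beta11 U * beta22 U - beta12 U ^ 2 = (detP U)⁻¹ from detBeta_eq hU, div_inv_eq_mul]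
  funext k
  cases d <;> fin_cases k <;>
  · simp only [ecFlux, flux, ecMom1, ecMom2, ecMass, hπ, avg_self, logAvg_self, detBeta_eq hU,
      beta11, beta12, beta22, vel, Matrix.cons_val, Fin.mk_one, Fin.zero_eta, Fin.reduceFinMk]
    try field_simp
    try ring

theorem ecEntropyFlux_self (d : Dir) {U : State} (hU : U ∈ admissible) :
    ecEntropyFlux d U U = entropyFlux d U := by
  rw [ecEntropyFlux, ecFlux_self d hU, avg_self, potential, ← two_smul ℝ, smul_smul]
  norm_num

/-- `V_L` and `ψ_L` are the averages minus half the jumps, and the two half jumps match by entropy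
conservation. -/
theorem dotProduct_ecFlux_left (d : Dir) {L R : State} (hL : L ∈ admissible)
    (hR : R ∈ admissible) :
    entropyVar L ⬝ᵥ ecFlux d L R = ecEntropyFlux d L R + potential d L := by
  have h := ecFlux_entropy_conservative d hL hR
  rw [sub_dotProduct] at h
  rw [ecEntropyFlux, smul_dotProduct, add_dotProduct, avg, smul_eq_mul]
  linarith

theorem dotProduct_ecFlux_right (d : Dir) {L R : State} (hL : L ∈ admissible)
    (hR : R ∈ admissible) :
    entropyVar R ⬝ᵥ ecFlux d L R = ecEntropyFlux d L R + potential d R := by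
  have h := ecFlux_entropy_conservative d hL hR
  rw [sub_dotProduct] at h
  rw [ecEntropyFlux, smul_dotProduct, add_dotProduct, avg, smul_eq_mul]
  linarith

/-- The second and fourth order fluxes conserve entropy in every cell. -/
theorem dotProduct_lineEcFlux_sub (o : Order) (d : Dir) {c : ℤ → State}
    (hc : ∀ l, c l ∈ admissible) (m : ℤ) :
    entropyVar (c m) ⬝ᵥ (lineEcFlux o d c m - lineEcFlux o d c (m - 1)) =
      lineEcEntropyFlux o d c m - lineEcEntropyFlux o d c (m - 1) := by
  -- In the fourth order case `F̃(U_{m-1}, U_{m+1})` occurs in both interface fluxes and cancels.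
  -- Every other two-point flux has `U_m` as an argument, so only the potential `ψ_m` appears, and
  -- it cancels between the two sides.
  have hr := dotProduct_ecFlux_left d (hc m) (hc (m + 1))
  have hl := dotProduct_ecFlux_right d (hc (m - 1)) (hc m)
  have hrr := dotProduct_ecFlux_left d (hc m) (hc (m + 2))
  have hll := dotProduct_ecFlux_right d (hc (m - 2)) (hc m)
  have i1 : m - 1 + 1 = m := by ring
  have i2 : m - 1 - 1 = m - 2 := by ring
  have i3 : m - 1 + 2 = m + 1 := by ring
  cases o <;>
  · simp only [lineEcFlux, lineEcEntropyFlux, i1, i2, i3, dotProduct_sub, dotProduct_smul,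
      dotProduct_add, smul_eq_mul, hr, hl, hrr, hll]
    ring

/-! ### Sign property of the reconstructions -/

/-! ### Undivided differences. -/

theorem undivDiff_congr {u w : ℤ → ℝ} (n : ℕ) (s : ℤ)
    (h : ∀ l, s ≤ l → l ≤ s + n → u l = w l) : undivDiff u n s = undivDiff w n s := by
  induction n generalizing s with
  | zero => exact h s le_rfl (by simp)
  | succ n ih =>
    simp only [undivDiff]
    rw [ih (s + 1) fun l h1 h2 => h l (by lia) (by push_cast; lia),
      ih s fun l h1 h2 => h l h1 (by push_cast; lia)]

theorem undivDiff_succ_eq_of_primitive {u w : ℤ → ℝ} (n : ℕ) (s : ℤ)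
    (h : ∀ l, s ≤ l → w (l + 1) - w l = u l) : undivDiff w (n + 1) s = undivDiff u n s := by
  induction n generalizing s with
  | zero => exact h s le_rfl
  | succ n ih =>
    rw [undivDiff, ih s h, ih (s + 1) fun l hl => h l (by lia), undivDiff]

theorem undivDiff_const (a : ℝ) (n : ℕ) (s : ℤ) :
    undivDiff (fun _ => a) (n + 1) s = 0 := by
  induction n generalizing s with
  | zero => simp [undivDiff]
  | succ n ih => rw [undivDiff, ih, ih, sub_zero]

theorem undivDiff_eval_eq_fwdDiff (p : Polynomial ℝ) (a : ℝ) (n : ℕ) (s : ℤ) :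
    undivDiff (fun l => p.eval (a + l)) n s = (fwdDiff 1)^[n] p.eval (a + s) := by
  induction n generalizing s with
  | zero => rfl
  | succ n ih =>
    rw [undivDiff, ih, ih, Function.iterate_succ_apply', fwdDiff]
    push_cast
    rw [add_assoc]

theorem undivDiff_eval (p : Polynomial ℝ) (a : ℝ) {n : ℕ} (hp : p.natDegree ≤ n) (s : ℤ) :
    undivDiff (fun l => p.eval (a + l)) n s = n.factorial * p.coeff n := by
  rw [undivDiff_eval_eq_fwdDiff]
  rcases hp.eq_or_lt with rfl | hlt
  · rw [Polynomial.fwdDiff_iter_degree_eq_factorial]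
    simp [mul_comm]
  · rw [Polynomial.fwdDiff_iter_eq_zero_of_degree_lt hlt, Polynomial.coeff_eq_zero_of_natDegree_lt hlt]
    simp

/-! ### Interpolation on equidistant nodes and shifts of the stencil. -/

theorem injOn_equidistant (a : ℝ) (t : Set ℕ) : Set.InjOn (fun j : ℕ => a + (j : ℝ)) t := by
  intro i _ j _ h
  simpa using h

/-- The polynomial of degree at most `n` with the values `w s, …, w (s + n)` at
`a, …, a + n`. -/
def equidistantInterp (n : ℕ) (a : ℝ) (w : ℤ → ℝ) (s : ℤ) : Polynomial ℝ :=
  Lagrange.interpolate (Finset.range (n + 1)) (fun j : ℕ => a + (j : ℝ))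
    (fun j : ℕ => w (s + (j : ℤ)))

theorem degree_equidistantInterp_lt (n : ℕ) (a : ℝ) (w : ℤ → ℝ) (s : ℤ) :
    (equidistantInterp n a w s).degree < (n + 1 : ℕ) :=
  (Lagrange.degree_interpolate_lt (s := Finset.range (n + 1))
    (fun j : ℕ => w (s + (j : ℤ))) (injOn_equidistant a _)).trans_eq (by rw [Finset.card_range])

theorem eval_equidistantInterp (n : ℕ) (a : ℝ) (w : ℤ → ℝ) (s : ℤ) {j : ℕ} (hj : j ≤ n) :
    (equidistantInterp n a w s).eval (a + j) = w (s + j) :=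
  Lagrange.eval_interpolate_at_node (s := Finset.range (n + 1))
    (fun j : ℕ => w (s + (j : ℤ))) (injOn_equidistant a _) (by simpa using Nat.lt_succ_of_le hj)

theorem coeff_equidistantInterp (n : ℕ) (a : ℝ) (w : ℤ → ℝ) (s : ℤ) :
    (equidistantInterp n a w s).coeff n = undivDiff w n s / n.factorial := by
  have hdeg : (equidistantInterp n a w s).natDegree ≤ n :=
    Polynomial.natDegree_le_iff_coeff_eq_zero.mpr fun m hm =>
      Polynomial.coeff_eq_zero_of_degree_lt
        ((degree_equidistantInterp_lt n a w s).trans_le (by exact_mod_cast hm))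
  -- The offset `a - s` makes the polynomial take the value `w l` at `a - s + l` for every `l` in
  -- the stencil.
  rw [eq_div_iff (by positivity), mul_comm, ← undivDiff_eval _ (a - s) hdeg s]
  refine undivDiff_congr n s fun l h1 h2 => ?_
  obtain ⟨j, rfl⟩ := Int.le.dest h1
  rw [← eval_equidistantInterp n a w s (j := j) (by lia)]
  congr 1
  push_cast
  ring

/-- Interpolation polynomials on neighbouring stencils differ by a multiple of the nodal
polynomial of the common nodes. -/
theorem equidistantInterp_succ_sub (n : ℕ) (a : ℝ) (w : ℤ → ℝ) (s : ℤ) :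
    equidistantInterp n (a + 1) w (s + 1) - equidistantInterp n a w s =
      Polynomial.C (undivDiff w (n + 1) s / n.factorial) *
        Lagrange.nodal (Finset.range n) (fun j : ℕ => a + 1 + (j : ℝ)) := by
  set N := Lagrange.nodal (Finset.range n) (fun j : ℕ => a + 1 + (j : ℝ)) with hN
  set c := undivDiff w (n + 1) s / n.factorial with hc
  have hNdeg : N.degree = n := by simp [hN, Lagrange.degree_nodal]
  have hNcoeff : N.coeff n = 1 := by
    have h := Lagrange.nodal_monic (s := Finset.range n) (v := fun j : ℕ => a + 1 + (j : ℝ))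
    rw [Polynomial.Monic, Polynomial.leadingCoeff, Lagrange.natDegree_nodal] at h
    simpa using h
  -- The coefficients of degree `n` cancel by the recursion for differences. The remainder has
  -- degree below `n` and vanishes at the `n` common nodes, so it is zero.
  have hlt : (equidistantInterp n (a + 1) w (s + 1) - equidistantInterp n a w s
      - Polynomial.C c * N).degree < n := by
    refine Polynomial.degree_lt_iff_coeff_zero _ _ |>.mpr fun m hm => ?_
    rcases hm.eq_or_lt with rfl | hm
    · rw [Polynomial.coeff_sub, Polynomial.coeff_sub, Polynomial.coeff_C_mul,
        coeff_equidistantInterp, coeff_equidistantInterp, hNcoeff, hc, undivDiff]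
      ring
    · have hz : ∀ b t, (equidistantInterp n b w t).coeff m = 0 := fun b t =>
        Polynomial.coeff_eq_zero_of_degree_lt
          ((degree_equidistantInterp_lt n b w t).trans_le (by exact_mod_cast hm))
      rw [Polynomial.coeff_sub, Polynomial.coeff_sub, Polynomial.coeff_C_mul, hz, hz,
        Polynomial.coeff_eq_zero_of_degree_lt (hNdeg.trans_lt (by exact_mod_cast hm))]
      simp
  rw [← sub_eq_zero]
  refine Polynomial.eq_zero_of_degree_lt_of_eval_index_eq_zero (s := Finset.range n)
    (v := fun j : ℕ => a + 1 + (j : ℝ)) (injOn_equidistant _ _) (by simpa using hlt) fun j hj => ?_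
  have hj' : j < n := by simpa using hj
  rw [Polynomial.eval_sub, Polynomial.eval_sub, Polynomial.eval_mul,
    eval_equidistantInterp _ _ _ _ hj'.le]
  have h1 : a + 1 + (j : ℝ) = a + ((j + 1 : ℕ) : ℝ) := by push_cast; ring
  rw [show Polynomial.eval (a + 1 + (j : ℝ)) N = 0 from
    Lagrange.eval_nodal_at_node (v := fun j : ℕ => a + 1 + (j : ℝ)) hj, h1,
    eval_equidistantInterp _ _ _ _ (by lia : j + 1 ≤ n)]
  push_cast
  rw [show s + 1 + (j : ℤ) = s + (j + 1) by ring]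
  simp

theorem fitPoly_pointValues (n : ℕ) (u : ℤ → ℝ) (s : ℤ) :
    fitPoly .pointValues (n + 1) u s = equidistantInterp n s u s := rfl

/-- Any primitive `w` will do, since another normalization adds a constant, which the derivative
removes. Neighbouring stencils can thus share one primitive. -/
theorem fitPoly_cellAverages (k : ℕ) {u w : ℤ → ℝ} (s : ℤ)
    (h : ∀ l, s ≤ l → w (l + 1) - w l = u l) :
    fitPoly .cellAverages k u s =
      Polynomial.derivative (equidistantInterp k ((s : ℝ) - 1 / 2) w s) := by
  have hsum : ∀ j : ℕ, ∑ l ∈ Finset.range j, u (s + (l : ℤ)) = w (s + j) - w s := by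
    intro j
    induction j with
    | zero => simp
    | succ j ih =>
      rw [Finset.sum_range_succ, ih, ← h (s + j) (by lia)]
      push_cast
      rw [add_assoc]
      ring
  have hnodes : (fun j : ℕ => (s : ℝ) + (j : ℝ) - 1 / 2) =
      fun j : ℕ => ((s : ℝ) - 1 / 2) + (j : ℝ) := by
    funext j; ring
  have hc : Lagrange.interpolate (Finset.range (k + 1)) (fun j : ℕ => ((s : ℝ) - 1 / 2) + (j : ℝ))
      (fun _ : ℕ => w s) = Polynomial.C (w s) := by
    symm
    refine Lagrange.eq_interpolate_of_eval_eq _ (injOn_equidistant _ _) ?_ (by simp)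
    exact Polynomial.degree_C_le.trans_lt (by simp; exact_mod_cast Nat.succ_pos k)
  have hsub : (fun j : ℕ => ∑ l ∈ Finset.range j, u (s + (l : ℤ))) =
      (fun j : ℕ => w (s + (j : ℤ))) - fun _ : ℕ => w s := funext hsum
  rw [fitPoly, hnodes, hsub, map_sub, hc, Polynomial.derivative_sub, Polynomial.derivative_C,
    sub_zero, equidistantInterp]

theorem fitPoly_cellAverages_succ_sub (k : ℕ) (u : ℤ → ℝ) (s : ℤ) :
    fitPoly .cellAverages k u (s + 1) - fitPoly .cellAverages k u s =
      Polynomial.C (undivDiff u k s / k.factorial) * Polynomial.derivative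
        (Lagrange.nodal (Finset.range k) (fun j : ℕ => (s : ℝ) - 1 / 2 + 1 + (j : ℝ))) := by
  obtain ⟨w, h⟩ : ∃ w : ℤ → ℝ, ∀ l, s ≤ l → w (l + 1) - w l = u l := by
    refine ⟨fun l : ℤ => ∑ i ∈ Finset.range (l - s).toNat, u (s + i), fun l hl => ?_⟩
    obtain ⟨j, rfl⟩ := Int.le.dest hl
    have h1 : (s + (j : ℤ) + 1 - s).toNat = j + 1 := by lia
    have h2 : (s + (j : ℤ) - s).toNat = j := by lia
    simp only [h1, h2, Finset.sum_range_succ]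
    ring
  rw [fitPoly_cellAverages k s h, fitPoly_cellAverages k (s + 1) fun l hl => h l (by lia),
    show ((s + 1 : ℤ) : ℝ) - 1 / 2 = (s : ℝ) - 1 / 2 + 1 by push_cast; ring,
    ← Polynomial.derivative_sub, equidistantInterp_succ_sub, undivDiff_succ_eq_of_primitive _ _ h,
    Polynomial.derivative_C_mul]

/-- The `i` factors with `l < i` are nonnegative and the other `n - i` are nonpositive; `n - i` and
`n + i` have the same parity. -/
theorem neg_one_pow_mul_prod_sub_nonneg (c : ℝ) {i n : ℕ} (hin : i ≤ n) (h1 : (i : ℝ) - 1 ≤ c)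
    (h2 : c ≤ i) : 0 ≤ (-1 : ℝ) ^ (n + i) * ∏ l ∈ Finset.range n, (c - l) := by
  induction n, hin using Nat.le_induction with
  | base =>
    rw [Even.neg_one_pow ⟨i, rfl⟩, one_mul]
    refine Finset.prod_nonneg fun l hl => ?_
    have : (l : ℝ) + 1 ≤ i := by exact_mod_cast Finset.mem_range.mp hl
    linarith
  | succ n hn ih =>
    rw [Finset.prod_range_succ, show n + 1 + i = n + i + 1 by ring, pow_succ]
    have : (i : ℝ) ≤ n := by exact_mod_cast hn
    nlinarith

theorem neg_one_pow_mul_prod_erase_sub_nonneg {i n : ℕ} (hin : i ≤ n) :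
    0 ≤ (-1 : ℝ) ^ (n + i) * ∏ l ∈ (Finset.range (n + 1)).erase i, ((i : ℝ) - l) := by
  induction n, hin using Nat.le_induction with
  | base =>
    rw [Even.neg_one_pow ⟨i, rfl⟩, one_mul]
    refine Finset.prod_nonneg fun l hl => ?_
    have h1 : l < i + 1 := Finset.mem_range.mp (Finset.mem_of_mem_erase hl)
    have : (l : ℝ) ≤ i := by exact_mod_cast Nat.lt_succ_iff.mp h1
    linarith
  | succ n hn ih =>
    rw [Finset.range_add_one, Finset.erase_insert_of_ne (by lia), Finset.prod_insert (by simp),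
      show n + 1 + i = n + i + 1 by ring, pow_succ]
    have : (i : ℝ) ≤ (n + 1 : ℕ) := by exact_mod_cast Nat.le_succ_of_le hn
    nlinarith

/-- At the interface `s + i + 1/2`, the fitted polynomials on the stencils that start at `s + 1`
and `s` differ by a multiple of the undivided difference on the union, of known sign. -/
theorem exists_eval_fitPoly_succ_sub (e : EnoKind) {n i : ℕ} (hin : i ≤ n) (u : ℤ → ℝ) (s : ℤ) :
    ∃ c : ℝ, 0 ≤ c ∧ (fitPoly e (n + 1) u (s + 1)).eval ((s : ℝ) + i + 1 / 2)
      - (fitPoly e (n + 1) u s).eval ((s : ℝ) + i + 1 / 2)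
      = c * ((-1) ^ (n + i) * undivDiff u (n + 1) s) := by
  have hsq : ((-1 : ℝ) ^ (n + i)) * (-1) ^ (n + i) = 1 := by rw [← mul_pow]; simp
  rw [← Polynomial.eval_sub]
  cases e with
  | pointValues =>
    -- Measured from the first common node `s + 1`, the interface lies at `i - 1/2`, between two
    -- integers.
    refine ⟨_, mul_nonneg (neg_one_pow_mul_prod_sub_nonneg ((i : ℝ) - 1 / 2) hin (by linarith)
      (by linarith)) (inv_nonneg.mpr (Nat.cast_nonneg n.factorial)), ?_⟩
    rw [fitPoly_pointValues, fitPoly_pointValues, show ((s + 1 : ℤ) : ℝ) = (s : ℝ) + 1 by simp,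
      equidistantInterp_succ_sub, Polynomial.eval_mul, Polynomial.eval_C, Lagrange.eval_nodal,
      Finset.prod_congr rfl (fun (l : ℕ) _ => show (s : ℝ) + i + 1 / 2 - ((s : ℝ) + 1 + l) =
        (i : ℝ) - 1 / 2 - l by ring)]
    rw [div_eq_mul_inv]
    linear_combination (-(undivDiff u (n + 1) s * (n.factorial : ℝ)⁻¹ *
      ∏ l ∈ Finset.range n, ((i : ℝ) - 1 / 2 - l))) * hsq
  | cellAverages =>
    refine ⟨_, mul_nonneg (neg_one_pow_mul_prod_erase_sub_nonneg hin)
      (inv_nonneg.mpr (Nat.cast_nonneg (n + 1).factorial)), ?_⟩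
    -- Here the nodes are the cell interfaces and the evaluation point is node `i` itself, where the
    -- derivative of the nodal polynomial is the product over the other nodes.
    have hnode := Lagrange.eval_nodal_derivative_eval_node_eq
      (v := fun j : ℕ => (s : ℝ) - 1 / 2 + 1 + (j : ℝ)) (s := Finset.range (n + 1)) (i := i)
      (by simpa using Nat.lt_succ_of_le hin)
    rw [fitPoly_cellAverages_succ_sub, Polynomial.eval_mul, Polynomial.eval_C,
      show (s : ℝ) + i + 1 / 2 = (s : ℝ) - 1 / 2 + 1 + i by ring, hnode, Lagrange.eval_nodal,
      Finset.prod_congr rfl (fun (l : ℕ) _ => show (s : ℝ) - 1 / 2 + 1 + i - ((s : ℝ) - 1 / 2 + 1 + l) =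
        (i : ℝ) - l by ring)]
    rw [div_eq_mul_inv]
    linear_combination (-(undivDiff u (n + 1) s * ((n + 1).factorial : ℝ)⁻¹ *
      ∏ l ∈ (Finset.range (n + 1)).erase i, ((i : ℝ) - l))) * hsq

/-! ### ENO stencils of neighbouring cells and the sign of the reconstructed jump. -/

theorem enoStart_mem (u : ℤ → ℝ) (i : ℤ) (n : ℕ) : i - n ≤ enoStart u i n ∧ enoStart u i n ≤ i := by
  induction n with
  | zero => simp [enoStart]
  | succ n ih =>
    rw [enoStart]
    push_cast
    split_ifs <;> lia

/-- The differences on the stencils between those of two neighbouring cells alternate in sign. -/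
theorem enoStart_alternating (u : ℤ → ℝ) (m : ℤ) (n : ℕ) :
    enoStart u m n ≤ enoStart u (m + 1) n ∧
      ∀ i : ℕ, enoStart u m n ≤ m - i → m - i < enoStart u (m + 1) n →
        0 ≤ (-1) ^ (n + i) * undivDiff u (n + 1) (m - i) * (u (m + 1) - u m) := by
  induction n with
  | zero =>
    refine ⟨by simp [enoStart], fun i h1 _ => ?_⟩
    have hi : i = 0 := by simpa [enoStart] using h1
    subst hi
    simpa [undivDiff] using mul_self_nonneg (u (m + 1) - u m)
  | succ n ih =>
    obtain ⟨hle, hsgn⟩ := ih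
    have hbs := enoStart_mem u m n
    have hbt := enoStart_mem u (m + 1) n
    rw [enoStart, enoStart]
    set s := enoStart u m n
    set t := enoStart u (m + 1) n
    set δ := u (m + 1) - u m
    rcases hle.eq_or_lt with heq | hlt
    -- The growth depends only on the current left end, so stencils that coincide once coincide
    -- forever.
    · rw [heq]
      exact ⟨le_rfl, fun i h1 h2 => absurd h2 (not_lt.mpr h1)⟩
    refine ⟨by split_ifs <;> lia, fun i h1 h2 => ?_⟩
    have hrec : undivDiff u (n + 1 + 1) (m - i) =
        undivDiff u (n + 1) (m - i + 1) - undivDiff u (n + 1) (m - i) := rfl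
    rw [hrec]
    have hpow : (-1 : ℝ) ^ (n + 1 + i) = -(-1) ^ (n + i) := by
      rw [show n + 1 + i = n + i + 1 by ring, pow_succ]; ring
    have hsgnAbs : |(-1 : ℝ) ^ (n + i)| = 1 := by simp
    rw [hpow]
    -- A difference of two numbers takes its sign from the one of larger modulus. This serves at the
    -- two ends of the range, where the induction hypothesis covers only one of the two lower
    -- differences; there the ENO choice says that the other is not larger.
    have key : ∀ σ a b δ : ℝ, |σ| = 1 → |b| ≤ |a| → 0 ≤ σ * a * δ → 0 ≤ -σ * (b - a) * δ := by
      intro σ a b δ hσ hab h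
      have h1 : |σ * b * δ| ≤ |σ * a * δ| := by
        rw [abs_mul, abs_mul, abs_mul, abs_mul]
        gcongr
      rw [abs_of_nonneg h] at h1
      have := le_abs_self (σ * b * δ)
      linarith
    by_cases hlast : m - i + 1 < t
    · obtain _ | i := i
      · lia
      have hnext := hsgn i (by split_ifs at h1 <;> lia) (by push_cast at hlast; lia)
      have hidx : m - ((i + 1 : ℕ) : ℤ) + 1 = m - i := by push_cast; ring
      have hpow' : (-1 : ℝ) ^ (n + (i + 1)) = -(-1) ^ (n + i) := by
        rw [← add_assoc, pow_succ]; ring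
      rw [hidx, hpow']
      -- Either both lower differences lie in the old range and have opposite signs, or the left
      -- stencil has just grown to the left.
      by_cases hfirst : s ≤ m - ((i + 1 : ℕ) : ℤ)
      · have hcur := hsgn (i + 1) hfirst (by lia)
        rw [hpow'] at hcur
        linarith
      · have hs : s - 1 = m - ((i + 1 : ℕ) : ℤ) := by split_ifs at h1 <;> lia
        have hs' : s = m - i := by push_cast at hs; lia
        have hcond : |undivDiff u (n + 1) (s - 1)| < |undivDiff u (n + 1) s| := by
          by_contra hc
          rw [if_neg hc] at h1
          exact hfirst h1
        rw [hs, hs'] at hcond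
        have := key _ _ _ δ (by simp : |(-1 : ℝ) ^ (n + i)| = 1) hcond.le hnext
        linarith
    · by_cases hfirst : s ≤ m - i
      -- The right end is new: the stencil of cell `m + 1` kept its left end `t`, so the difference
      -- at `t` is at most that at `t - 1` in modulus. A tie is harmless.
      · have ht : t - 1 = m - i := by split_ifs at h2 <;> lia
        have ht' : t = m - i + 1 := by lia
        have hcond : ¬ |undivDiff u (n + 1) (t - 1)| < |undivDiff u (n + 1) t| := by
          intro hc
          rw [if_pos hc] at h2
          lia
        rw [ht, ht', not_lt] at hcond
        exact key _ _ _ δ hsgnAbs hcond (hsgn i hfirst (by lia))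
      · split_ifs at h1 h2 <;> lia

/-- A telescoping sum: every step between the stencils contributes with the sign of the jump. -/
theorem eval_fitPoly_sub_mul_nonneg (e : EnoKind) (n : ℕ) (u : ℤ → ℝ) (m : ℤ) (b : ℝ) {s t : ℤ}
    (hs : m - n ≤ s) (ht : t ≤ m + 1) (hst : s ≤ t)
    (h : ∀ i : ℕ, s ≤ m - i → m - i < t → 0 ≤ (-1) ^ (n + i) * undivDiff u (n + 1) (m - i) * b) :
    0 ≤ ((fitPoly e (n + 1) u t).eval ((m : ℝ) + 1 / 2)
      - (fitPoly e (n + 1) u s).eval ((m : ℝ) + 1 / 2)) * b := by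
  induction t, hst using Int.leInduction with
  | base => simp
  | succ t hst ih =>
    have h1 := ih (by lia) fun i h2 h3 => h i h2 (by lia)
    obtain ⟨i, hi⟩ := Int.le.dest (show t ≤ m by lia)
    have hti : t = m - i := by lia
    obtain ⟨c, hc, hstep⟩ := exists_eval_fitPoly_succ_sub e (n := n) (i := i) (by lia) u t
    have hm : (t : ℝ) + i = m := by exact_mod_cast hi
    rw [hm] at hstep
    have h2 := h i (by lia) (by lia)
    rw [← hti] at h2
    have h3 := mul_nonneg hc h2
    rw [← mul_assoc, ← mul_assoc, mul_assoc c, ← hstep] at h3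
    linarith

theorem enoValue_jump_mul_nonneg (e : EnoKind) (n : ℕ) (u : ℤ → ℝ) (m : ℤ) :
    0 ≤ (enoValue e (n + 1) u (m + 1) ((m : ℝ) + 1 / 2)
      - enoValue e (n + 1) u m ((m : ℝ) + 1 / 2)) * (u (m + 1) - u m) := by
  obtain ⟨hle, hsgn⟩ := enoStart_alternating u m n
  exact eval_fitPoly_sub_mul_nonneg e n u m _ (enoStart_mem u m n).1 (enoStart_mem u (m + 1) n).2
    hle hsgn

theorem minmod_mul_le (a b : ℝ) : minmod a b * a ≤ a ^ 2 ∧ minmod a b * b ≤ b ^ 2 := by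
  unfold minmod
  split_ifs with h1 h2
  · have := min_le_left a b
    have := min_le_right a b
    constructor <;> nlinarith
  · have := le_max_left a b
    have := le_max_right a b
    constructor <;> nlinarith
  · constructor <;> nlinarith

/-- The sign property: the jump of the reconstruction has the sign of the jump of the data. -/
theorem reconstruct_jump_mul_nonneg (o : Order) (e : EnoKind) (u : ℤ → ℝ) (m : ℤ) :
    0 ≤ (reconstruct o e u (m + 1) ((m : ℝ) + 1 / 2) - reconstruct o e u m ((m : ℝ) + 1 / 2)) *
      (u (m + 1) - u m) := by
  cases o with
  | O2 =>
    -- Each of the two slopes takes at most half of the jump away, as the minmod slope does not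
    -- exceed the jump in its direction.
    have h1 := (minmod_mul_le (u m - u (m - 1)) (u (m + 1) - u m)).2
    have h2 := (minmod_mul_le (u (m + 1) - u m) (u (m + 1 + 1) - u (m + 1))).1
    simp only [reconstruct, add_sub_cancel_right]
    push_cast
    nlinarith
  | O3 => exact enoValue_jump_mul_nonneg e 2 u m
  | O4 => exact enoValue_jump_mul_nonneg e 3 u m

theorem reconstruct_const (o : Order) (e : EnoKind) (a : ℝ) (m : ℤ) :
    reconstruct o e (fun _ => a) (m + 1) ((m : ℝ) + 1 / 2) =
      reconstruct o e (fun _ => a) m ((m : ℝ) + 1 / 2) := by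
  have eno : ∀ n : ℕ, enoValue e (n + 1) (fun _ => a) (m + 1) ((m : ℝ) + 1 / 2) =
      enoValue e (n + 1) (fun _ => a) m ((m : ℝ) + 1 / 2) := by
    intro n
    have h := fun b : ℝ => eval_fitPoly_sub_mul_nonneg e n (fun _ => a) m b
      (enoStart_mem (fun _ => a) m n).1 (enoStart_mem (fun _ => a) (m + 1) n).2
      (enoStart_alternating (fun _ => a) m n).1 (fun i _ _ => by simp [undivDiff_const])
    -- All differences of constant data vanish, so the factor `b` is free; `b = 1` and `b = -1` give
    -- both inequalities.
    have h1 := h 1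
    have h2 := h (-1)
    rw [enoValue, enoValue, Nat.add_sub_cancel]
    linarith
  cases o with
  | O2 => simp [reconstruct, minmod]
  | O3 => exact eno 2
  | O4 => exact eno 3

/-! ### Dissipation -/

theorem det_ne_zero_of_mulVec_injective {M : Matrix (Fin 6) (Fin 6) ℝ}
    (h : ∀ z, M *ᵥ z = 0 → z = 0) : M.det ≠ 0 := fun hM => by
  obtain ⟨z, hz, hMz⟩ := Matrix.exists_mulVec_eq_zero_iff.mpr hM
  exact hz (h z hMz)

theorem det_primJacobian_ne_zero {U : State} (hU : U ∈ admissible) : (primJacobian U).det ≠ 0 := by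
  have h0 : depth U ≠ 0 := hU.1.ne'
  refine det_ne_zero_of_mulVec_injective fun z hz => ?_
  have e := fun k => congrFun hz k
  simp only [primJacobian, mulVec, dotProduct, Fin.sum_univ_six, of_apply, Pi.zero_apply] at e
  have e0 := e 0
  have e1 := e 1
  have e2 := e 2
  have e3 := e 3
  have e4 := e 4
  have e5 := e 5
  simp only [Matrix.cons_val, zero_mul, one_mul, add_zero] at e0 e1 e2 e3 e4 e5
  have z0 : z 0 = 0 := e0
  have z1 : z 1 = 0 := by simpa [z0, h0] using e1
  have z2 : z 2 = 0 := by simpa [z0, h0] using e2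
  have z3 : z 3 = 0 := by simpa [z0, z1, z2, h0] using e3
  have z4 : z 4 = 0 := by simpa [z0, z1, z2, h0] using e4
  have z5 : z 5 = 0 := by simpa [z0, z1, z2, h0] using e5
  funext k
  fin_cases k <;> assumption

theorem det_eigvecPrim_ne_zero (d : Dir) {U : State} (hU : U ∈ admissible) :
    (eigvecPrim d U).det ≠ 0 := by
  -- With abstract coefficients the elimination serves both directions; for `y` the rows are
  -- exchanged.
  have kernel : ∀ {h p q a b : ℝ} {z : State}, h ≠ 0 → p ≠ 0 → a ≠ 0 → b ≠ 0 →
      h * p * z 0 + -h * z 2 + h * p * z 5 = 0 →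
      -(a * p) * z 0 + a * p * z 5 = 0 →
      -(a * q) * z 0 + -b * z 1 + b * z 4 + a * q * z 5 = 0 →
      2 * p ^ 2 * z 0 + p * z 2 + 2 * p ^ 2 * z 5 = 0 →
      2 * p * q * z 0 + p * z 1 + q * z 2 + p * z 4 + 2 * p * q * z 5 = 0 →
      2 * q ^ 2 * z 0 + 2 * q * z 1 + z 3 + 2 * q * z 4 + 2 * q ^ 2 * z 5 = 0 → z = 0 := by
    intro h p q a b z hh hp ha hb e0 e1 e2 e3 e4 e5
    have z5 : z 5 = z 0 := mul_left_cancel₀ (mul_ne_zero ha hp) (by linarith)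
    have z2 : z 2 = 2 * p * z 0 := mul_left_cancel₀ hh (by rw [z5] at e0; linarith)
    have z0 : z 0 = 0 := by
      rw [z5, z2] at e3
      have : p ^ 2 * z 0 = 0 := by linarith
      simpa [hp] using this
    rw [z0, mul_zero] at z2
    rw [z0] at z5
    simp only [z0, z2, z5, mul_zero, zero_add, add_zero] at e2 e4 e5
    have z4 : z 4 = z 1 := mul_left_cancel₀ hb (by linarith)
    have z1 : z 1 = 0 := mul_left_cancel₀ hp (by rw [z4] at e4; linarith)
    rw [z1] at z4
    have z3 : z 3 = 0 := by simpa [z1, z4] using e5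
    funext k
    fin_cases k <;> assumption
  have hh : depth U ≠ 0 := hU.1.ne'
  refine det_ne_zero_of_mulVec_injective fun z hz => ?_
  have e := fun k => congrFun hz k
  cases d
  all_goals
    simp only [eigvecPrim, mulVec, dotProduct, Fin.sum_univ_six, of_apply, Pi.zero_apply] at e
    have e0 := e 0
    have e1 := e 1
    have e2 := e 2
    have e3 := e 3
    have e4 := e 4
    have e5 := e 5
    simp only [Matrix.cons_val, zero_mul, one_mul, add_zero] at e0 e1 e2 e3 e4 e5
  · have hp := p11_pos hU
    exact kernel hh hp.ne' (by positivity) (Real.sqrt_pos.mpr hp).ne' e0 e1 e2 e3 e4 e5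
  · have hp := p22_pos hU
    exact kernel hh hp.ne' (by positivity) (Real.sqrt_pos.mpr hp).ne' e0 e2 e1 e5 e4 e3

theorem det_scaling_ne_zero (d : Dir) {U : State} (hU : U ∈ admissible) :
    (scaling d U).det ≠ 0 := by
  have hh : 0 < depth U := hU.1
  have hp := pdd_pos d hU
  have hD := detP_pos hU
  have hα : 0 < scaleAlpha d U := by unfold scaleAlpha; positivity
  have ha : √(1 / (12 * depth U * pdd d U ^ 2)) ≠ 0 := by positivity
  have hb : √(detP U / (4 * depth U * pdd d U ^ 2)) ≠ 0 := by positivity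
  have hblock : (1 / (3 * depth U) + scaleR d U) / scaleAlpha d U *
      ((√3 * detP U * (√3 * detP U + pdd d U) + p12 U ^ 4) /
        (3 * depth U * pdd d U ^ 2 * scaleAlpha d U))
      - (p12 U ^ 2 / (3 * depth U * pdd d U * scaleAlpha d U)) ^ 2 ≠ 0 := by
    have hs3 : √3 * √3 = 3 := Real.mul_self_sqrt (by norm_num)
    -- With `√3` moved to the numerator, the block determinant below is an identity in a free
    -- variable in place of `√3`.
    have hr : scaleR d U = √3 * detP U / (3 * depth U * pdd d U) := by
      unfold scaleR
      rw [div_eq_div_iff (by positivity) (by positivity)]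
      linear_combination (-(detP U * depth U * pdd d U)) * hs3
    have : (1 / (3 * depth U) + scaleR d U) / scaleAlpha d U *
        ((√3 * detP U * (√3 * detP U + pdd d U) + p12 U ^ 4) /
          (3 * depth U * pdd d U ^ 2 * scaleAlpha d U))
        - (p12 U ^ 2 / (3 * depth U * pdd d U * scaleAlpha d U)) ^ 2 =
        √3 * detP U * ((√3 * detP U + pdd d U) ^ 2 + p12 U ^ 4) /
          (9 * depth U ^ 2 * pdd d U ^ 3 * scaleAlpha d U ^ 2) := by
      rw [hr]
      generalize √3 = w
      field_simp
      ring
    rw [this]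
    positivity
  refine det_ne_zero_of_mulVec_injective fun z hz => ?_
  have e := fun k => congrFun hz k
  simp only [scaling, mulVec, dotProduct, Fin.sum_univ_six, of_apply, Pi.zero_apply] at e
  have e0 := e 0
  have e1 := e 1
  have e2 := e 2
  have e3 := e 3
  have e4 := e 4
  have e5 := e 5
  simp only [Matrix.cons_val, zero_mul, add_zero, zero_add] at e0 e1 e2 e3 e4 e5
  generalize (1 / (3 * depth U) + scaleR d U) / scaleAlpha d U = t33 at *
  generalize p12 U ^ 2 / (3 * depth U * pdd d U * scaleAlpha d U) = t34 at *
  generalize (√3 * detP U * (√3 * detP U + pdd d U) + p12 U ^ 4) /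
    (3 * depth U * pdd d U ^ 2 * scaleAlpha d U) = t44 at *
  have z0 := (mul_eq_zero_iff_left ha).mp e0
  have z1 := (mul_eq_zero_iff_left hb).mp e1
  have z2 : z 2 = 0 := (mul_eq_zero_iff_left hblock).mp (by linear_combination t44 * e2 - t34 * e3)
  have z3 : z 3 = 0 := (mul_eq_zero_iff_left hblock).mp (by linear_combination t33 * e3 - t34 * e2)
  have z4 := (mul_eq_zero_iff_left hb).mp e4
  have z5 := (mul_eq_zero_iff_left ha).mp e5
  funext k
  fin_cases k <;> assumption

theorem isUnit_det_scaledEigvec (d : Dir) {U : State} (hU : U ∈ admissible) :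
    IsUnit (scaledEigvec d U).det := by
  rw [scaledEigvec, det_mul, det_mul, isUnit_iff_ne_zero]
  exact mul_ne_zero (mul_ne_zero (det_primJacobian_ne_zero hU) (det_eigvecPrim_ne_zero d hU))
    (det_scaling_ne_zero d hU)

theorem maxSpeed_nonneg (d : Dir) (U : State) : 0 ≤ maxSpeed d U :=
  (abs_nonneg _).trans (Finset.le_sup' (fun k => |eigval d U k|) (Finset.mem_univ 0))

theorem transpose_mulVec_reconstructedJump {S : SchemeData} (hS : S.WellPosed) (d : Dir)
    {c : ℤ → State} (hc : ∀ l, c l ∈ admissible) (m : ℤ) :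
    (faceEigvec S d c m)ᵀ *ᵥ reconstructedJump S d c m =
      scaledTrace S d c m (m + 1) - scaledTrace S d c m m := by
  have hR : IsUnit (faceEigvec S d c m)ᵀ.det := by
    rw [det_transpose]
    exact isUnit_det_scaledEigvec d (hS d _ (hc m) _ (hc (m + 1))).1
  rw [reconstructedJump, entropyVarTrace, entropyVarTrace, ← mulVec_sub, mulVec_mulVec,
    mul_nonsing_inv _ hR, one_mulVec]

/-- The two scalings agree in the jump across the interface itself, and the sign property sees no
other jump of the data. -/
theorem scaledVar_jump (S : SchemeData) (d : Dir) (c : ℤ → State) (m : ℤ) :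
    scaledVar S d c m (m + 1) - scaledVar S d c m m =
      (faceEigvec S d c m)ᵀ *ᵥ (entropyVar (c (m + 1)) - entropyVar (c m)) := by
  unfold scaledVar
  cases S.scaling with
  | frozen => rw [mulVec_sub]
  | jumpwise =>
    have h : Finset.Ico m (m + 1) = {m} := by ext; simp; lia
    simp [h]

/-- The factor `R̃ᵀ` of `D` undoes the inverse in `⟦Ṽ⟧`. The vector `w` is the jump of `V` for
stability and its average for consistency. -/
theorem dotProduct_faceDiffusion_jump {S : SchemeData} (hS : S.WellPosed) (d : Dir)
    {c : ℤ → State} (hc : ∀ l, c l ∈ admissible) (m : ℤ) (w : State) :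
    w ⬝ᵥ (faceDiffusion S d c m *ᵥ reconstructedJump S d c m) =
      maxSpeed d (S.speedState d (c m) (c (m + 1))) * (((faceEigvec S d c m)ᵀ *ᵥ w) ⬝ᵥ
        (scaledTrace S d c m (m + 1) - scaledTrace S d c m m)) := by
  rw [faceDiffusion, ← mulVec_mulVec, transpose_mulVec_reconstructedJump hS d hc,
    ← mulVec_mulVec, dotProduct_mulVec, ← mulVec_transpose, faceLambda,
    ← smul_one_eq_diagonal, smul_mulVec, one_mulVec, dotProduct_smul, smul_eq_mul]

/-- The diffusion term dissipates entropy. -/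
theorem diffusion_nonneg {S : SchemeData} (hS : S.WellPosed) (d : Dir)
    {c : ℤ → State} (hc : ∀ l, c l ∈ admissible) (m : ℤ) :
    0 ≤ (entropyVar (c (m + 1)) - entropyVar (c m)) ⬝ᵥ
      (faceDiffusion S d c m *ᵥ reconstructedJump S d c m) := by
  rw [dotProduct_faceDiffusion_jump hS d hc, ← scaledVar_jump]
  refine mul_nonneg (maxSpeed_nonneg _ _) (Finset.sum_nonneg fun k _ => ?_)
  rw [mul_comm]
  exact reconstruct_jump_mul_nonneg S.order S.eno (fun l => scaledVar S d c m l k) m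

/-- Entropy balance of one coordinate direction in the cell `m`. -/
theorem esEntropyFlux_sub_le {S : SchemeData} (hS : S.WellPosed) (d : Dir)
    {c : ℤ → State} (hc : ∀ l, c l ∈ admissible) (m : ℤ) :
    esEntropyFlux S d c m - esEntropyFlux S d c (m - 1) ≤
      entropyVar (c m) ⬝ᵥ (esFlux S d c m - esFlux S d c (m - 1)) := by
  have hec := dotProduct_lineEcFlux_sub S.order d hc m
  -- `V_m` differs from `V̄` by minus half a jump at `m + 1/2` and by plus half a jump at `m - 1/2`.
  -- The gap in the inequality is therefore a quarter of the sum of these two nonnegative terms.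
  have hr := diffusion_nonneg hS d hc m
  have hl := diffusion_nonneg hS d hc (m - 1)
  rw [sub_add_cancel] at hl
  simp only [esEntropyFlux, esFlux, sub_add_cancel, dotProduct_sub, dotProduct_smul,
    smul_dotProduct, add_dotProduct, sub_dotProduct, smul_eq_mul] at hec hr hl ⊢
  linarith

/-! ### Consistency and entropy stability -/

theorem scaledVar_const (S : SchemeData) (d : Dir) (W : State) (m l : ℤ) :
    scaledVar S d (fun _ => W) m l = scaledVar S d (fun _ => W) m m := by
  unfold scaledVar
  cases S.scaling <;> simp

theorem esEntropyFlux_const {S : SchemeData} (hS : S.WellPosed) (d : Dir) {W : State}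
    (hW : W ∈ admissible) (m : ℤ) : esEntropyFlux S d (fun _ => W) m = entropyFlux d W := by
  have htrace : scaledTrace S d (fun _ => W) m (m + 1) = scaledTrace S d (fun _ => W) m m := by
    funext k
    have h : (fun l => scaledVar S d (fun _ => W) m l k) =
        fun _ => scaledVar S d (fun _ => W) m m k :=
      funext fun l => congrFun (scaledVar_const S d W m l) k
    rw [scaledTrace, scaledTrace, h]
    exact reconstruct_const _ _ _ m
  rw [esEntropyFlux, dotProduct_faceDiffusion_jump hS d fun _ => hW, htrace, sub_self,
    dotProduct_zero, mul_zero, mul_zero, sub_zero]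
  cases S.order <;> simp only [lineEcEntropyFlux, ecEntropyFlux_self d hW]
  all_goals ring

theorem dotProduct_nonconsTerm (o : Order) (g Δx Δy : ℝ) {G : ℤ → ℤ → State} {i j : ℤ}
    (h : G i j ∈ admissible) : entropyVar (G i j) ⬝ᵥ nonconsTerm o g Δx Δy G i j = 0 := by
  rw [nonconsTerm, dotProduct_add, dotProduct_smul, dotProduct_smul, dotProduct_nonconsCoeff g _ h,
    dotProduct_nonconsCoeff g _ h, smul_zero, smul_zero, add_zero]

theorem esEntropyFlux_balance_le {S : SchemeData} (hS : S.WellPosed) (g : ℝ) {Δx Δy : ℝ}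
    (hΔx : 0 < Δx) (hΔy : 0 < Δy) {G : ℤ → ℤ → State} (hG : ∀ i j, G i j ∈ admissible)
    (i j : ℤ) :
    1 / Δx * (esEntropyFlux S .x (lineX G j) i - esEntropyFlux S .x (lineX G j) (i - 1))
      + 1 / Δy * (esEntropyFlux S .y (lineY G i) j - esEntropyFlux S .y (lineY G i) (j - 1))
      ≤ entropyVar (G i j) ⬝ᵥ schemeResidual S g Δx Δy G i j := by
  rw [schemeResidual, dotProduct_add, dotProduct_nonconsTerm _ _ _ _ (hG i j), add_zero,
    dotProduct_add, dotProduct_smul, dotProduct_smul, smul_eq_mul, smul_eq_mul]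
  exact add_le_add
    (mul_le_mul_of_nonneg_left (esEntropyFlux_sub_le hS .x (c := lineX G j) (fun l => hG l j) i)
      (by positivity))
    (mul_le_mul_of_nonneg_left (esEntropyFlux_sub_le hS .y (c := lineY G i) (fun l => hG i l) j)
      (by positivity))

theorem hasDerivWithinAt_entropy {u : ℝ → State} {u' : State} {I : Set ℝ} {t : ℝ}
    (hu : HasDerivWithinAt u u' I t) (ht : u t ∈ admissible) :
    HasDerivWithinAt (fun τ => entropy (u τ)) (entropyVar (u t) ⬝ᵥ u') I t := by
  rw [entropyVar_eq ht, ← fderiv_entropy_apply ht]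
  exact (hasFDerivAt_entropy ht).comp_hasDerivWithinAt t hu

end ShearShallowWater

end

theorem mainTheorem2 (S : ShearShallowWater.SchemeData) (hS : S.WellPosed)
    (g Δx Δy : ℝ) (hg : 0 < g) (hΔx : 0 < Δx) (hΔy : 0 < Δy) :
    (∀ (d : ShearShallowWater.Dir), ∀ W ∈ ShearShallowWater.admissible, ∀ m : ℤ,
      ShearShallowWater.esEntropyFlux S d (fun _ => W) m = ShearShallowWater.entropyFlux d W) ∧
    (∀ (I : Set ℝ) (C : Set (ℤ × ℤ)) (U : ℝ → ℤ → ℤ → ShearShallowWater.State),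
      ShearShallowWater.IsSolution S g Δx Δy I C U →
      ∀ t ∈ I, ∀ i j : ℤ, (i, j) ∈ C →
        ∃ e : ℝ, HasDerivWithinAt (fun τ => ShearShallowWater.entropy (U τ i j)) e I t ∧
          e + 1 / Δx *
              (ShearShallowWater.esEntropyFlux S .x (ShearShallowWater.lineX (U t) j) i
                - ShearShallowWater.esEntropyFlux S .x (ShearShallowWater.lineX (U t) j) (i - 1))
            + 1 / Δy *
              (ShearShallowWater.esEntropyFlux S .y (ShearShallowWater.lineY (U t) i) j
                - ShearShallowWater.esEntropyFlux S .y (ShearShallowWater.lineY (U t) i) (j - 1))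
            ≤ 0) := by
  refine ⟨fun d W hW m => ShearShallowWater.esEntropyFlux_const hS d hW m, ?_⟩
  intro I C U hU t ht i j hij
  refine ⟨_, ShearShallowWater.hasDerivWithinAt_entropy (hU.scheme t ht i j hij)
    (hU.mem_admissible t ht i j), ?_⟩
  have h := ShearShallowWater.esEntropyFlux_balance_le hS g hΔx hΔy (hU.mem_admissible t ht) i j
  rw [dotProduct_neg]
  linarith
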